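/- **Setting.** Let $L,M,N$ be nonnegative integers, $P:=M+L$, $\gamma>0$. Let $F\in\mathbb C^{P\times M}$ be a precoder of full rank $M$, and put $G:=I_N\otimes F\in\mathbb C^{PN\times MN}$. For $v=(v_0,\dots,v_{k-1})$ let $\mathcal T_v$ be the banded Toeplitz (convolution) matrix with $PN+L$ rows and $PN+L+1-k$ columns whose $(i,j)$ entry is $v_{i-j}$ if $0\le i-j<k$ and $0$ otherwise. For a channel vector $h\in\mathbb C^{L+1}$ and a channel input $x\in\mathbb C^{PN}$, the received signal is $y=\mathcal T_h x+n\in\mathbb C^{PN+L}$, where $n$ is circularly-symmetric complex Gaussian with mean $0$ and covariance $I$. The channel input is $x=\sqrt\gamma\,Gs$ with source symbols $s\in\mathbb C^{MN}$ that satisfy the pilot constraint $As=c$ for a known matrix $A$ and a known vector $c$. Let $U_n$ be a matrix whose columns form an orthonormal basis of $\{z: z^HG=0\}$, let $G^\dagger$ be the Moore–Penrose inverse of $G$, and let $$\Theta:=\Bigl\{(h,x)\in\mathbb C^{L+1}\times\mathbb C^{PN} : U_n^Hx=0,\ A G^\dagger x=\sqrt\gamma\,c\Bigr\}.$$ Let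 $\tilde E$ be a matrix whose columns form an orthonormal basis of the null space of $\begin{bmatrix}U_n^H\\ AG^\dagger\end{bmatrix}$. An unbiased semi-blind channel estimator is a measurable map $\hat h:\mathbb C^{PN+L}\to\mathbb C^{L+1}$ such that, for every $\theta=(h,x)\in\Theta$, $\hat h(y)$ is integrable under the law of $y$ for $\theta$ and $\mathsf E_\theta[\hat h(y)]=h$. **Corollary (variance lower bound for semi-blind channel estimators).** Let $\hat h$ be an unbiased semi-blind channel estimator. Let $h\in\mathbb C^{L+1}$ and $s\in\mathbb C^{MN}$ with $As=c$ be the true channel and the true source symbols, and let $\tilde U$ be a matrix whose columns form an orthonormal basis of $\{z: z^H\mathcal T_h\tilde E=0\}$. Then $$\mathsf E\,\|\hat h(y)-h\|^2\ \ge\ \frac1\gamma\sum_{\ell=0}^{L}\sigma_\ell^{-2},$$ where the expectation is taken at $\theta=(h,\sqrt\gamma\,Gs)$, $\|\cdot\|$ is the Euclidean norm, and $\sigma_0\ge\sigma_1\ge\dots\ge\sigma_L\ge 0$ are the singular values of $\mathcal T_{Gs}^H\tilde U$ in decreasing order (continued by zeros if the matrix has fewer than $L+1$ columns). Both sides are read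 in $[0,\infty]$, with $0^{-2}=\infty$. -/

import Mathlib

open MeasureTheory ProbabilityTheory
open scoped Matrix Kronecker NNReal ENNReal

noncomputable section

namespace SemiBlind

/-- The banded Toeplitz (convolution) matrix `𝒯_v` with `r` rows and `c` columns: its `(i, j)` entry
is `v_{i-j}` if `0 ≤ i - j < k`, and `0` otherwise. It is used with `r + 1 = k + c`. -/
def toeplitz {k : ℕ} (v : Fin k → ℂ) (r c : ℕ) : Matrix (Fin r) (Fin c) ℂ :=
  Matrix.of fun i j =>
    if hij : (j : ℕ) ≤ (i : ℕ) ∧ (i : ℕ) - (j : ℕ) < k then v ⟨(i : ℕ) - (j : ℕ), hij.2⟩ else 0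

/-- The block precoder `I_N ⊗ F`, where the `p`-th entry of the `n`-th block has the linear index
`P * n + p`. -/
def blockPrecoder (N : ℕ) {P M : ℕ} (F : Matrix (Fin P) (Fin M) ℂ) :
    Matrix (Fin (N * P)) (Fin (N * M)) ℂ :=
  Matrix.reindex finProdFinEquiv finProdFinEquiv ((1 : Matrix (Fin N) (Fin N) ℂ) ⊗ₖ F)

/-- The Moore-Penrose generalized inverse `G† = (Gᴴ G)⁻¹ Gᴴ` of a matrix `G` of full column rank;
see `pinv_penrose`. -/
def pinv {m n : ℕ} (G : Matrix (Fin m) (Fin n) ℂ) : Matrix (Fin n) (Fin m) ℂ :=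
  (Gᴴ * G)⁻¹ * Gᴴ

/-- For a matrix of full column rank, `pinv` satisfies the four Penrose equations (which determine
the generalized inverse uniquely). -/
theorem pinv_penrose {m n : ℕ} (G : Matrix (Fin m) (Fin n) ℂ) (hG : G.rank = n) :
    G * pinv G * G = G ∧ pinv G * G * pinv G = pinv G ∧
      (G * pinv G)ᴴ = G * pinv G ∧ (pinv G * G)ᴴ = pinv G * G := by
  have hu : IsUnit (Gᴴ * G) := by
    rw [← Matrix.mulVec_surjective_iff_isUnit]
    have h2 : (Gᴴ * G).rank = n := by
      open scoped ComplexOrder in rw [Matrix.rank_conjTranspose_mul_self, hG]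
    have h3 : LinearMap.range (Gᴴ * G).mulVecLin = ⊤ :=
      Submodule.eq_top_of_finrank_eq (by rw [← Matrix.rank, h2, Module.finrank_fin_fun])
    exact LinearMap.range_eq_top.1 h3
  have h1 : pinv G * G = 1 := by
    rw [pinv, Matrix.mul_assoc]
    exact Matrix.nonsing_inv_mul _ ((Matrix.isUnit_iff_isUnit_det _).1 hu)
  refine ⟨by rw [Matrix.mul_assoc, h1, Matrix.mul_one], by rw [h1, Matrix.one_mul], ?_,
    by rw [h1, Matrix.conjTranspose_one]⟩
  simp only [pinv, Matrix.conjTranspose_mul, Matrix.conjTranspose_nonsing_inv,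
    Matrix.conjTranspose_conjTranspose, Matrix.mul_assoc]

/-- The columns of `U` form an orthonormal basis of the subspace `S` of `ℂ^m`. -/
def IsOrthonormalBasisOf {m k : ℕ} (U : Matrix (Fin m) (Fin k) ℂ)
    (S : Submodule ℂ (Fin m → ℂ)) : Prop :=
  Uᴴ * U = 1 ∧ LinearMap.range U.mulVecLin = S

/-- The left null space `{z | zᴴ B = 0}` of `B`, i.e. the orthogonal complement of the column space
of `B`. -/
def leftNullSpace {m n : ℕ} (B : Matrix (Fin m) (Fin n) ℂ) : Submodule ℂ (Fin m → ℂ) :=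
  LinearMap.ker Bᴴ.mulVecLin

/-- The circularly-symmetric complex Gaussian distribution on `ℂ` with mean `0` and variance
`E|z|² = 1`: the real and imaginary parts are independent real Gaussians of variance `1/2`. -/
def complexGaussian : Measure ℂ :=
  ((gaussianReal 0 (1 / 2)).prod (gaussianReal 0 (1 / 2))).map Complex.measurableEquivRealProd.symm

/-- The law of additive white Gaussian noise: circularly-symmetric complex Gaussian on `ℂ^m` with
mean `0` and covariance matrix `I`. -/
def noiseLaw (m : ℕ) : Measure (Fin m → ℂ) :=
  Measure.pi fun _ => complexGaussian

/-- The law of the received signal `y = 𝒯_h x + n` for the parameter `θ = (h, x)`, where `h` is the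
channel vector (order `L`) and `x` the channel input (length `K`). -/
def receivedLaw {L K : ℕ} (θ : (Fin (L + 1) → ℂ) × (Fin K → ℂ)) : Measure (Fin (K + L) → ℂ) :=
  (noiseLaw (K + L)).map fun n => toeplitz θ.1 (K + L) K *ᵥ θ.2 + n

/-- The matrix `[U_nᴴ; A G†]` of the constraints on the channel input, where `G = I ⊗ F`. -/
def constraintMatrix {K R u q : ℕ} (G : Matrix (Fin K) (Fin R) ℂ) (Un : Matrix (Fin K) (Fin u) ℂ)
    (A : Matrix (Fin q) (Fin R) ℂ) : Matrix (Fin u ⊕ Fin q) (Fin K) ℂ :=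
  Matrix.fromRows Unᴴ (A * pinv G)

/-- The constrained parameter space `Θ` of all `(h, x)` such that `U_nᴴ x = 0` (redundant precoding)
and `A G† x = √γ c` (pilot symbols: `A s = c` for `x = √γ G s`). There is no constraint on `h`. -/
def parameterSpace (L : ℕ) {K R u q : ℕ} (γ : ℝ) (G : Matrix (Fin K) (Fin R) ℂ)
    (Un : Matrix (Fin K) (Fin u) ℂ) (A : Matrix (Fin q) (Fin R) ℂ) (c : Fin q → ℂ) :
    Set ((Fin (L + 1) → ℂ) × (Fin K → ℂ)) :=
  {θ | constraintMatrix G Un A *ᵥ θ.2 = Sum.elim (0 : Fin u → ℂ) (((√γ : ℝ) : ℂ) • c)}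

/-- `hhat` is an unbiased estimator of the channel vector: `E_θ[hhat(y)] = h` for every
`θ = (h, x) ∈ Θ`. -/
def IsUnbiasedChannelEstimator {L K : ℕ} (Θ : Set ((Fin (L + 1) → ℂ) × (Fin K → ℂ)))
    (hhat : (Fin (K + L) → ℂ) → (Fin (L + 1) → ℂ)) : Prop :=
  Measurable hhat ∧ ∀ θ ∈ Θ,
    Integrable hhat (receivedLaw θ) ∧ ∫ y, hhat y ∂(receivedLaw θ) = θ.1

/-- The mean square error `E_θ ‖hhat(y) - h‖²` (Euclidean norm) at `θ = (h, x)`, as an extended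
nonnegative real. -/
def meanSquareError {L K : ℕ} (hhat : (Fin (K + L) → ℂ) → (Fin (L + 1) → ℂ))
    (θ : (Fin (L + 1) → ℂ) × (Fin K → ℂ)) : ℝ≥0∞ :=
  ∫⁻ y, ‖WithLp.toLp 2 (hhat y - θ.1)‖ₑ ^ 2 ∂(receivedLaw θ)

/-- The singular values of a matrix in decreasing order, indexed from `0` and continued by zeros. -/
def singularValue {m n : ℕ} (B : Matrix (Fin m) (Fin n) ℂ) (i : ℕ) : ℝ :=
  (Matrix.toEuclideanLin B).singularValues i

end SemiBlind

end

noncomputable section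

namespace SemiBlind

/-! Everything rests on the matrix C = E[(ĥ(y) - h) nᴴ]. Put x = √γ G s. Unbiasedness holds along
each line (h + tδ, x + tz) inside Θ, and translating the Gaussian noise moves the parameter from the
merely measurable estimator into an explicit density. Differentiating at t = 0 gives C (𝒯_δ x + 𝒯_h
z) = δ (`errorNoiseCorrelation_mulVec`). Since the admissible z are the range of Ẽ, this says C 𝒯_x
= 1 and C 𝒯_h Ẽ = 0.

The second identity gives C = C Ũ Ũᴴ, so √γ C Ũ is a left inverse of Wᴴ for W = 𝒯_{Gs}ᴴ Ũ. A left
inverse of Wᴴ has squared Frobenius norm at least ∑ σ_ℓ⁻² (`sum_inv_sq_singularValue_le`).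
Conversely ‖C Ũ‖_F² ≤ ‖C‖_F², and ‖C‖_F² is at most the mean square error by Bessel's inequality,
because the noise coordinates are orthonormal in L². No Fisher information matrix is inverted, and a
singular W simply excludes a finite mean square error. -/

instance : IsProbabilityMeasure complexGaussian :=
  Measure.isProbabilityMeasure_map (by fun_prop)

instance (m : ℕ) : IsProbabilityMeasure (noiseLaw m) := by
  unfold noiseLaw; infer_instance

/-! ### Densities of translated Gaussian noise. -/

theorem map_const_add_gaussianReal_half (a : ℝ) :
    (gaussianReal 0 (1 / 2)).map (fun x => a + x) =
      (gaussianReal 0 (1 / 2)).withDensity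
        fun x => ENNReal.ofReal (Real.exp (2 * (a * x) - a ^ 2)) := by
  have hv : (1 / 2 : ℝ≥0) ≠ 0 := by norm_num
  rw [gaussianReal_map_const_add, gaussianReal_of_var_ne_zero _ hv,
    gaussianReal_of_var_ne_zero _ hv, ← withDensity_mul _ (by fun_prop) (by fun_prop)]
  congr 1
  ext x
  simp only [gaussianPDF, Pi.mul_apply]
  rw [← ENNReal.ofReal_mul (gaussianPDFReal_nonneg _ _ _)]
  congr 1
  simp only [gaussianPDFReal]
  -- As 2v = 1, the exponents only have to satisfy -(x - a)² = -x² + 2ax - a².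
  rw [mul_assoc (√_)⁻¹, ← Real.exp_add]
  congr 2
  push_cast
  ring

theorem complexGaussian_eq_map :
    complexGaussian = ((gaussianReal 0 (1 / 2)).prod (gaussianReal 0 (1 / 2))).map
      Complex.measurableEquivRealProd.symm := rfl

theorem lintegral_complexGaussian (f : ℂ → ℝ≥0∞) :
    ∫⁻ z, f z ∂complexGaussian =
      ∫⁻ p, f ⟨p.1, p.2⟩ ∂((gaussianReal 0 (1 / 2)).prod (gaussianReal 0 (1 / 2))) :=
  lintegral_map_equiv f Complex.measurableEquivRealProd.symm

theorem integral_complexGaussian (f : ℂ → ℂ) :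
    ∫ z, f z ∂complexGaussian =
      ∫ p, f ⟨p.1, p.2⟩ ∂((gaussianReal 0 (1 / 2)).prod (gaussianReal 0 (1 / 2))) :=
  integral_map_equiv Complex.measurableEquivRealProd.symm f

theorem lintegral_const_add_complexGaussian (a : ℂ) {f : ℂ → ℝ≥0∞} (hf : Measurable f) :
    ∫⁻ z, f (a + z) ∂complexGaussian =
      ∫⁻ z, ENNReal.ofReal (Real.exp (2 * (star a * z).re - Complex.normSq a)) * f z
        ∂complexGaussian := by
  have hm : Measurable fun p : ℝ × ℝ => (⟨p.1, p.2⟩ : ℂ) :=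
    Complex.measurableEquivRealProd.symm.measurable
  rw [lintegral_complexGaussian, lintegral_complexGaussian]
  set μ := gaussianReal 0 (1 / 2)
  let T : ℝ × ℝ → ℝ × ℝ := Prod.map (fun x => a.re + x) (fun x => a.im + x)
  have hT : (μ.prod μ).map T = (μ.prod μ).withDensity fun p =>
      ENNReal.ofReal (Real.exp (2 * (a.re * p.1) - a.re ^ 2)) *
        ENNReal.ofReal (Real.exp (2 * (a.im * p.2) - a.im ^ 2)) := by
    rw [← Measure.map_prod_map _ _ (by fun_prop) (by fun_prop), map_const_add_gaussianReal_half,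
      map_const_add_gaussianReal_half, prod_withDensity (by fun_prop) (by fun_prop)]
  have h1 : ∫⁻ p, f (a + ⟨p.1, p.2⟩) ∂(μ.prod μ) =
      ∫⁻ p, f ⟨p.1, p.2⟩ ∂((μ.prod μ).map T) := by
    rw [lintegral_map (f := fun p : ℝ × ℝ => f ⟨p.1, p.2⟩) (hf.comp hm) (by fun_prop)]
    refine lintegral_congr fun p => ?_
    congr 1
  rw [h1, hT, lintegral_withDensity_eq_lintegral_mul _ (by fun_prop)
    (g := fun p : ℝ × ℝ => f ⟨p.1, p.2⟩) (hf.comp hm)]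
  refine lintegral_congr fun p => ?_
  simp only [Pi.mul_apply]
  rw [← ENNReal.ofReal_mul (Real.exp_pos _).le, ← Real.exp_add]
  congr 3
  simp [Complex.normSq_apply]
  ring

/-- The logarithm of the density of `a + n` with respect to the law of `n`, where `n` is the
noise. -/
def logLikelihoodRatio {m : ℕ} (a n : Fin m → ℂ) : ℝ :=
  ∑ i, (2 * (star (a i) * n i).re - Complex.normSq (a i))

@[fun_prop]
theorem measurable_logLikelihoodRatio {m : ℕ} (a : Fin m → ℂ) :
    Measurable (logLikelihoodRatio a) := by
  unfold logLikelihoodRatio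
  fun_prop

/-- The density factorizes over the independent coordinates, so it is enough to compare both
measures on boxes. -/
theorem map_const_add_noiseLaw {m : ℕ} (a : Fin m → ℂ) :
    (noiseLaw m).map (fun n => a + n) =
      (noiseLaw m).withDensity fun n => ENNReal.ofReal (Real.exp (logLikelihoodRatio a n)) := by
  have h1 : (noiseLaw m).map (fun n => a + n) =
      Measure.pi fun i => complexGaussian.map fun z => a i + z := by
    have := fun i => (Measure.isProbabilityMeasure_map (μ := complexGaussian)
      (f := fun z => a i + z) (by fun_prop))
    exact Measure.pi_map_pi (f := fun i z => a i + z) (by fun_prop)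
  rw [h1]
  have := fun i => (Measure.isProbabilityMeasure_map (μ := complexGaussian)
      (f := fun z => a i + z) (by fun_prop))
  refine Measure.pi_eq fun s hs => ?_
  rw [withDensity_apply _ (MeasurableSet.univ_pi hs),
    ← lintegral_indicator (MeasurableSet.univ_pi hs)]
  have h2 : ∀ n : Fin m → ℂ, (Set.univ.pi s).indicator
      (fun n => ENNReal.ofReal (Real.exp (logLikelihoodRatio a n))) n =
      ∏ i, (s i).indicator (fun z => ENNReal.ofReal
        (Real.exp (2 * (star (a i) * z).re - Complex.normSq (a i)))) (n i) := by
    intro n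
    by_cases hn : n ∈ Set.univ.pi s
    · rw [Set.indicator_of_mem hn, logLikelihoodRatio, Real.exp_sum,
        ENNReal.ofReal_prod_of_nonneg fun i _ => (Real.exp_pos _).le]
      exact Finset.prod_congr rfl fun i _ => by rw [Set.indicator_of_mem (hn i trivial)]
    · rw [Set.indicator_of_notMem hn]
      simp only [Set.mem_pi, Set.mem_univ, true_imp_iff, not_forall] at hn
      obtain ⟨i, hi⟩ := hn
      exact (Finset.prod_eq_zero (Finset.mem_univ i) (Set.indicator_of_notMem hi _)).symm
  have h3 : ∀ i, Measurable ((s i).indicator (fun z => ENNReal.ofReal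
        (Real.exp (2 * (star (a i) * z).re - Complex.normSq (a i))))) := fun i =>
    Measurable.indicator (by fun_prop) (hs i)
  rw [lintegral_congr h2, noiseLaw,
    lintegral_prod_eq_prod_lintegral_of_indepFun Finset.univ
      (fun i (n : Fin m → ℂ) => (s i).indicator (fun z => ENNReal.ofReal
        (Real.exp (2 * (star (a i) * z).re - Complex.normSq (a i)))) (n i))]
  · refine Finset.prod_congr rfl fun i _ => ?_
    rw [(measurePreserving_eval (fun _ : Fin m => complexGaussian) i).lintegral_comp (h3 i),
      ← lintegral_indicator_one (hs i), lintegral_map (by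
        exact measurable_one.indicator (hs i)) (by fun_prop),
      lintegral_const_add_complexGaussian _ (measurable_one.indicator (hs i))]
    refine lintegral_congr fun z => ?_
    by_cases hz : z ∈ s i <;> simp [hz]
  · exact iIndepFun_pi (X := fun i => (s i).indicator (fun z => ENNReal.ofReal
        (Real.exp (2 * (star (a i) * z).re - Complex.normSq (a i)))))
        fun i => (h3 i).aemeasurable
  · exact fun i => (h3 i).comp (measurable_pi_apply i)

/-- Moves the shift from `f`, which need not be smooth, to an exponential that can be differentiated
in `a`. -/
theorem integral_const_add_noiseLaw {m : ℕ} (a : Fin m → ℂ) {f : (Fin m → ℂ) → ℂ}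
    (hf : Measurable f) :
    ∫ n, f (a + n) ∂noiseLaw m =
      ∫ n, (Real.exp (logLikelihoodRatio a n) : ℂ) * f n ∂noiseLaw m := by
  have h1 : ∫ n, f (a + n) ∂noiseLaw m = ∫ n, f n ∂((noiseLaw m).map fun n => a + n) :=
    (integral_map (by fun_prop) hf.aestronglyMeasurable).symm
  rw [h1, map_const_add_noiseLaw, integral_withDensity_eq_integral_toReal_smul (by fun_prop)
    (by simp)]
  refine integral_congr_ae (.of_forall fun n => ?_)
  simp [ENNReal.toReal_ofReal (Real.exp_pos _).le]

/-! ### Exponential moments and covariance of the noise. -/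

theorem integrable_exp_mul_abs_gaussianReal (v : ℝ≥0) (K : ℝ) :
    Integrable (fun x => Real.exp (K * |x|)) (gaussianReal 0 v) := by
  refine Integrable.mono' ((integrable_exp_mul_gaussianReal (μ := 0) (v := v) K).add
    (integrable_exp_mul_gaussianReal (μ := 0) (v := v) (-K))) (by fun_prop) (.of_forall fun x => ?_)
  rw [Real.norm_of_nonneg (Real.exp_pos _).le]
  simp only [Pi.add_apply]
  rcases abs_cases x with ⟨h, _⟩ | ⟨h, _⟩ <;> rw [h]
  · linarith [Real.exp_pos (-K * x)]
  · have : K * -x = -K * x := by ring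
    rw [this]
    linarith [Real.exp_pos (K * x)]

theorem integrable_exp_mul_norm_complexGaussian {K : ℝ} (hK : 0 ≤ K) :
    Integrable (fun z : ℂ => Real.exp (K * ‖z‖)) complexGaussian := by
  have h := (integrable_exp_mul_abs_gaussianReal (1 / 2) K).mul_prod
    (integrable_exp_mul_abs_gaussianReal (1 / 2) K)
  rw [complexGaussian_eq_map, integrable_map_equiv]
  refine h.mono' (by
    refine Measurable.aestronglyMeasurable ?_
    exact Measurable.comp (g := fun z : ℂ => Real.exp (K * ‖z‖)) (by fun_prop)
      Complex.measurableEquivRealProd.symm.measurable) (.of_forall fun p => ?_)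
  rw [← Real.exp_add, ← mul_add, Function.comp, Real.norm_of_nonneg (Real.exp_pos _).le]
  gcongr
  exact Complex.norm_le_abs_re_add_abs_im _

theorem integrable_exp_mul_sum_norm_noiseLaw (m : ℕ) {K : ℝ} (hK : 0 ≤ K) :
    Integrable (fun n : Fin m → ℂ => Real.exp (K * ∑ i, ‖n i‖)) (noiseLaw m) := by
  have h := Integrable.fintype_prod (f := fun (_ : Fin m) (z : ℂ) => Real.exp (K * ‖z‖))
    (μ := fun _ => complexGaussian) fun _ => integrable_exp_mul_norm_complexGaussian hK
  refine h.congr (.of_forall fun n => ?_)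
  simp [Finset.mul_sum, Real.exp_sum]

theorem integral_complexGaussian_id : ∫ z, z ∂complexGaussian = 0 := by
  have hi : Integrable (fun x : ℝ => (x : ℂ)) (gaussianReal 0 (1 / 2)) :=
    (memLp_one_iff_integrable.1 (memLp_id_gaussianReal 1)).ofReal
  have h0 : ∫ x : ℝ, (x : ℂ) ∂gaussianReal 0 (1 / 2) = 0 := by
    rw [integral_complex_ofReal, integral_id_gaussianReal, Complex.ofReal_zero]
  rw [integral_complexGaussian]
  simp_rw [Complex.mk_eq_add_mul_I]
  rw [integral_add (hi.comp_fst _) ((hi.comp_snd _).mul_const _), integral_mul_const,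
    integral_fun_fst (fun x : ℝ => (x : ℂ)), integral_fun_snd (fun x : ℝ => (x : ℂ)), h0]
  simp

theorem integral_complexGaussian_mul_star : ∫ z, z * star z ∂complexGaussian = 1 := by
  have hi : Integrable (fun x : ℝ => ((x ^ 2 : ℝ) : ℂ)) (gaussianReal 0 (1 / 2)) :=
    (memLp_id_gaussianReal 2).integrable_sq.ofReal
  have h0 : ∫ x : ℝ, ((x ^ 2 : ℝ) : ℂ) ∂gaussianReal 0 (1 / 2) = 1 / 2 := by
    have h := variance_fun_id_gaussianReal (μ := 0) (v := 1 / 2)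
    rw [variance_eq_integral (by fun_prop), integral_id_gaussianReal] at h
    simp only [sub_zero] at h
    rw [integral_complex_ofReal, h]
    simp
  rw [integral_complexGaussian]
  have h1 : ∀ p : ℝ × ℝ, (⟨p.1, p.2⟩ : ℂ) * star (⟨p.1, p.2⟩ : ℂ) =
      ((p.1 ^ 2 : ℝ) : ℂ) + ((p.2 ^ 2 : ℝ) : ℂ) := fun p => by
    apply Complex.ext <;> simp [pow_two]; ring
  simp_rw [h1]
  rw [integral_add (hi.comp_fst _) (hi.comp_snd _),
    integral_fun_fst (fun x : ℝ => ((x ^ 2 : ℝ) : ℂ)),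
    integral_fun_snd (fun x : ℝ => ((x ^ 2 : ℝ) : ℂ)), h0]
  norm_num

theorem memLp_noiseLaw_apply {m : ℕ} (j : Fin m) :
    MemLp (fun n : Fin m → ℂ => n j) 2 (noiseLaw m) := by
  refine (memLp_two_iff_integrable_sq_norm
    (measurable_pi_apply j).aestronglyMeasurable).2 ?_
  refine (integrable_exp_mul_sum_norm_noiseLaw m (K := 2) (by norm_num)).mono'
    ((measurable_pi_apply j).norm.pow_const 2).aestronglyMeasurable
    (.of_forall fun n => ?_)
  rw [norm_pow, norm_norm, two_mul, Real.exp_add, ← pow_two]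
  gcongr
  exact (Finset.single_le_sum (f := fun i => ‖n i‖) (fun i _ => norm_nonneg _)
    (Finset.mem_univ j)).trans ((le_add_of_nonneg_right zero_le_one).trans (Real.add_one_le_exp _))

theorem integral_noiseLaw_mul_star {m : ℕ} (i j : Fin m) :
    ∫ n, n i * star (n j) ∂noiseLaw m = if i = j then 1 else 0 := by
  split_ifs with h
  · subst h
    rw [← integral_complexGaussian_mul_star]
    exact integral_comp_eval (μ := fun _ : Fin m => complexGaussian) (i := i)
      (f := fun z : ℂ => z * star z) (by fun_prop)
  · have hind : IndepFun (fun n : Fin m → ℂ => n i) (fun n => star (n j)) (noiseLaw m) :=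
      ((iIndepFun_pi (μ := fun _ : Fin m => complexGaussian) (X := fun _ z => z)
        fun _ => aemeasurable_id).indepFun h).comp measurable_id continuous_star.measurable
    have h0 : ∫ n, n i ∂noiseLaw m = 0 := by
      rw [← integral_complexGaussian_id]
      exact integral_comp_eval (μ := fun _ : Fin m => complexGaussian) (i := i)
        (f := fun z : ℂ => z) (by fun_prop)
    have := hind.integral_mul_eq_mul_integral
      (measurable_pi_apply i).aestronglyMeasurable
      (continuous_star.measurable.comp (measurable_pi_apply j)).aestronglyMeasurable
    simp only [Pi.mul_apply] at this
    rw [h0, zero_mul] at this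
    exact this

/-! ### Differentiating the likelihood ratio under the integral. -/

theorem logLikelihoodRatio_path {m : ℕ} (D R n : Fin m → ℂ) (t : ℝ) :
    logLikelihoodRatio (fun i => t * D i + t ^ 2 * R i) n =
      t * (∑ i, 2 * (star (D i) * n i).re) +
        t ^ 2 * ((∑ i, 2 * (star (R i) * n i).re) - ∑ i, Complex.normSq (D i)) -
        t ^ 3 * (∑ i, 2 * (star (D i) * R i).re) - t ^ 4 * ∑ i, Complex.normSq (R i) := by
  simp only [logLikelihoodRatio, Finset.mul_sum, ← Finset.sum_add_distrib,
    ← Finset.sum_sub_distrib]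
  refine Finset.sum_congr rfl fun i _ => ?_
  have h2 : ((t : ℂ) ^ 2) = ((t ^ 2 : ℝ) : ℂ) := by push_cast; rfl
  simp only [h2, Complex.normSq_apply, Complex.star_def, Complex.mul_re, Complex.conj_re,
    Complex.conj_im, Complex.add_re, Complex.add_im, Complex.mul_im, Complex.ofReal_re,
    Complex.ofReal_im]
  ring

theorem abs_sum_two_mul_re_le {m : ℕ} (D n : Fin m → ℂ) :
    |∑ i, 2 * (star (D i) * n i).re| ≤ (2 * ∑ i, ‖D i‖) * ∑ i, ‖n i‖ := by
  calc |∑ i, 2 * (star (D i) * n i).re|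
      ≤ ∑ i, (2 * ‖D i‖) * ‖n i‖ := by
        refine (Finset.abs_sum_le_sum_abs _ _).trans (Finset.sum_le_sum fun i _ => ?_)
        rw [abs_mul, abs_two, mul_assoc, ← norm_star (D i), ← norm_mul]
        gcongr
        exact Complex.abs_re_le_norm _
    _ ≤ ∑ i, (2 * ‖D i‖) * ∑ j, ‖n j‖ := by
        gcongr with i
        exact Finset.single_le_sum (f := fun i => ‖n i‖) (fun i _ => norm_nonneg _)
          (Finset.mem_univ i)
    _ = _ := by rw [← Finset.sum_mul, ← Finset.mul_sum]

/-- The derivative of a likelihood ratio along a quartic exponent is dominated by an exponential. -/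
theorem abs_mul_exp_le {p p' q : ℝ} (hp : |p| ≤ q) (hp' : |p'| ≤ q) :
    |p' * Real.exp p| ≤ Real.exp (2 * q) := by
  rw [abs_mul, Real.abs_exp, two_mul, Real.exp_add]
  gcongr
  · linarith [Real.add_one_le_exp q]
  · exact (le_abs_self p).trans hp

/-- The signal is bilinear in (h, x), so its displacement along a line is tD + t²R and the exponent
is quartic in t. Only its linear coefficient, the score 2 Re(Dᴴ n), survives at t = 0. For |t| < 1
the derivative is dominated by an exponential of ∑ ‖n i‖ times ‖g‖, a product of two L² functions.
-/
theorem hasDerivAt_integral_likelihoodRatio {m : ℕ} {g : (Fin m → ℂ) → ℂ}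
    (hg : MemLp g 2 (noiseLaw m)) (D R : Fin m → ℂ) :
    HasDerivAt (fun t : ℝ => ∫ n, (Real.exp (logLikelihoodRatio
        (fun i => t * D i + t ^ 2 * R i) n) : ℂ) * g n ∂noiseLaw m)
      (∫ n, ((∑ i, 2 * (star (D i) * n i).re : ℝ) : ℂ) * g n ∂noiseLaw m) 0 := by
  set S : (Fin m → ℂ) → ℝ := fun n => ∑ i, ‖n i‖ with hS
  set a : (Fin m → ℂ) → ℝ := fun n => ∑ i, 2 * (star (D i) * n i).re with ha
  set b : (Fin m → ℂ) → ℝ := fun n => ∑ i, 2 * (star (R i) * n i).re with hb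
  set c2 := ∑ i, Complex.normSq (D i)
  set c3 := ∑ i, 2 * (star (D i) * R i).re
  set c4 := ∑ i, Complex.normSq (R i)
  -- The weights 2, 3, 4 are those of the t-derivative of the quartic, so one bound serves both the
  -- exponent and its derivative.
  let A := 2 * |c2| + 3 * |c3| + 4 * |c4|
  let B := (2 * ∑ i, ‖D i‖) + 2 * (2 * ∑ i, ‖R i‖)
  have hB : 0 ≤ B := by positivity
  let p : ℝ → (Fin m → ℂ) → ℝ := fun t n =>
    t * a n + t ^ 2 * (b n - c2) - t ^ 3 * c3 - t ^ 4 * c4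
  let p' : ℝ → (Fin m → ℂ) → ℝ := fun t n =>
    a n + 2 * t * (b n - c2) - 3 * t ^ 2 * c3 - 4 * t ^ 3 * c4
  have hSm : Measurable S := by fun_prop
  have ham : Measurable a := by fun_prop
  have hbm : Measurable b := by fun_prop
  have hd : ∀ t n, HasDerivAt (fun t => p t n) (p' t n) t := fun t n => by
    have h := ((((hasDerivAt_id t).mul_const (a n)).add
      ((hasDerivAt_pow 2 t).mul_const (b n - c2))).sub
      ((hasDerivAt_pow 3 t).mul_const c3)).sub ((hasDerivAt_pow 4 t).mul_const c4)
    refine (h.congr_deriv ?_)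
    simp [p']
  have hbound : ∀ n, ∀ t ∈ Metric.ball (0 : ℝ) 1, |p t n| ≤ A + B * S n ∧
      |p' t n| ≤ A + B * S n := by
    intro n t ht
    have ht1 : |t| ≤ 1 := by
      rw [Metric.mem_ball, dist_zero_right] at ht; exact ht.le
    have h1 : |a n| ≤ (2 * ∑ i, ‖D i‖) * S n := abs_sum_two_mul_re_le D n
    have h2 : |b n| ≤ (2 * ∑ i, ‖R i‖) * S n := abs_sum_two_mul_re_le R n
    have hu : ∀ (k : ℕ) (x : ℝ), |t ^ k * x| ≤ |x| := fun k x => by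
      rw [abs_mul, abs_pow]
      exact mul_le_of_le_one_left (abs_nonneg x) (pow_le_one₀ (abs_nonneg t) ht1)
    have hABS : A + B * S n = 2 * |c2| + 3 * |c3| + 4 * |c4| + (2 * ∑ i, ‖D i‖) * S n
        + 2 * ((2 * ∑ i, ‖R i‖) * S n) := by
      simp only [A, B]; ring
    rw [hABS]
    have hbc := abs_sub (b n) c2
    have h10 := abs_nonneg c2
    have h11 := abs_nonneg c3
    have h12 := abs_nonneg c4
    have h14 := abs_nonneg (b n)
    constructor
    · have e1 := abs_le.1 (hu 1 (a n))
      have e2 := abs_le.1 (hu 2 (b n - c2))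
      have e3 := abs_le.1 (hu 3 c3)
      have e4 := abs_le.1 (hu 4 c4)
      rw [pow_one] at e1
      exact abs_le.2 ⟨by simp only [p]; linarith, by simp only [p]; linarith⟩
    · have e1 := abs_le.1 h1
      have e2 := abs_le.1 (hu 1 (b n - c2))
      have e3 := abs_le.1 (hu 2 c3)
      have e4 := abs_le.1 (hu 3 c4)
      rw [pow_one] at e2
      have hp' : p' t n = a n + 2 * (t * (b n - c2)) - 3 * (t ^ 2 * c3) - 4 * (t ^ 3 * c4) := by
        simp only [p']; ring
      rw [hp']
      exact abs_le.2 ⟨by linarith, by linarith⟩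
  have hdom : Integrable (fun n => Real.exp (2 * (A + B * S n)) * ‖g n‖) (noiseLaw m) := by
    have h1 : MemLp (fun n => Real.exp (2 * (A + B * S n))) 2 (noiseLaw m) := by
      rw [memLp_two_iff_integrable_sq (by fun_prop)]
      have h := (integrable_exp_mul_sum_norm_noiseLaw m (K := 4 * B) (by positivity)).const_mul
        (Real.exp (4 * A))
      refine h.congr (.of_forall fun n => ?_)
      simp only [hS]
      rw [← Real.exp_add, ← Real.exp_nat_mul]
      congr 1
      push_cast
      ring
    exact h1.integrable_mul hg.norm
  have hpm : ∀ t, Measurable (p t) := fun t => by fun_prop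
  have hF : ∀ (t : ℝ) n, (Real.exp (logLikelihoodRatio (fun i => t * D i + t ^ 2 * R i) n) : ℂ) * g n =
      (Real.exp (p t n) : ℂ) * g n := fun t n => by rw [logLikelihoodRatio_path]
  simp_rw [hF]
  have key := (hasDerivAt_integral_of_dominated_loc_of_deriv_le (μ := noiseLaw m) (𝕜 := ℝ)
    (F := fun t n => (Real.exp (p t n) : ℂ) * g n)
    (F' := fun t n => ((p' t n * Real.exp (p t n) : ℝ) : ℂ) * g n) (x₀ := 0)
    (bound := fun n => Real.exp (2 * (A + B * S n)) * ‖g n‖)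
    (Metric.ball_mem_nhds 0 one_pos)
    (.of_forall fun t => ((Complex.measurable_ofReal.comp
      (hpm t).exp).aestronglyMeasurable.mul hg.1))
    ?_ ?_ ?_ hdom ?_).2
  · refine key.congr_deriv (integral_congr_ae (.of_forall fun n => ?_))
    have h0 : p' 0 n * Real.exp (p 0 n) = a n := by simp [p, p']
    change ((p' 0 n * Real.exp (p 0 n) : ℝ) : ℂ) * g n = (a n : ℂ) * g n
    rw [h0]
  · simpa [p] using hg.integrable one_le_two
  · refine ((Complex.measurable_ofReal.comp ?_).aestronglyMeasurable.mul hg.1)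
    fun_prop
  · refine .of_forall fun n t ht => ?_
    rw [norm_mul, Complex.norm_real]
    exact mul_le_mul_of_nonneg_right (abs_mul_exp_le (hbound n t ht).1 (hbound n t ht).2)
      (norm_nonneg _)
  · refine .of_forall fun n t _ => ?_
    have h := ((hd t n).exp.ofReal_comp).mul_const (g n)
    refine h.congr_deriv ?_
    rw [mul_comm (Real.exp _)]

/-! ### Bessel's inequality, Frobenius norms and singular values. -/

/-- **Bessel's inequality** for the coordinates of the noise. -/
theorem sum_norm_sq_integral_mul_star_le {m : ℕ} {g : (Fin m → ℂ) → ℂ}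
    (hg : MemLp g 2 (noiseLaw m)) :
    ∑ j, ‖∫ n, g n * star (n j) ∂noiseLaw m‖ ^ 2 ≤ ∫ n, ‖g n‖ ^ 2 ∂noiseLaw m := by
  have hm := fun j => memLp_noiseLaw_apply (m := m) j
  let v : Fin m → Lp ℂ 2 (noiseLaw m) := fun j => (hm j).toLp
  have hin : ∀ {f₁ f₂ : (Fin m → ℂ) → ℂ} (h₁ : MemLp f₁ 2 (noiseLaw m))
      (h₂ : MemLp f₂ 2 (noiseLaw m)),
      inner ℂ h₁.toLp h₂.toLp = ∫ n, f₂ n * star (f₁ n) ∂noiseLaw m := by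
    intro f₁ f₂ h₁ h₂
    rw [L2.inner_def]
    refine integral_congr_ae ?_
    filter_upwards [h₁.coeFn_toLp, h₂.coeFn_toLp] with n e₁ e₂
    rw [e₁, e₂]
    rfl
  have hv : Orthonormal ℂ v := by
    rw [orthonormal_iff_ite]
    intro i j
    rw [hin, integral_noiseLaw_mul_star]
    simp only [eq_comm]
  have h := hv.sum_inner_products_le (x := hg.toLp) (s := Finset.univ)
  simp only [v, hin] at h
  refine h.trans (le_of_eq ?_)
  have h2 := hin hg hg
  rw [inner_self_eq_norm_sq_to_K] at h2
  have h3 : ∀ n, g n * star (g n) = ((‖g n‖ ^ 2 : ℝ) : ℂ) := fun n => by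
    rw [Complex.star_def, Complex.mul_conj, Complex.normSq_eq_norm_sq]
  simp_rw [h3] at h2
  rw [integral_complex_ofReal] at h2
  exact Complex.ofReal_injective ((Complex.ofReal_pow _ _).trans h2)

/-- A matrix `B` sends an orthonormal family to vectors whose squared norms add up to at most the
squared Frobenius norm of `B`. -/
theorem sum_norm_sq_toEuclideanLin_le {r k : ℕ} (B : Matrix (Fin r) (Fin k) ℂ) {ι : Type*}
    [Fintype ι] {v : ι → EuclideanSpace ℂ (Fin k)} (hv : Orthonormal ℂ v) :
    ∑ l, ‖Matrix.toEuclideanLin B (v l)‖ ^ 2 ≤ ∑ i, ∑ j, ‖B i j‖ ^ 2 := by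
  simp_rw [EuclideanSpace.norm_sq_eq]
  rw [Finset.sum_comm]
  refine Finset.sum_le_sum fun i _ => ?_
  -- Bessel's inequality for the conjugate of row i, whose inner products with the family are the
  -- i-th coordinates of the images up to conjugation.
  have h := hv.sum_inner_products_le (x := WithLp.toLp 2 fun j => star (B i j))
    (s := Finset.univ)
  rw [EuclideanSpace.norm_sq_eq] at h
  simp only [norm_star] at h
  refine le_trans (Finset.sum_le_sum fun l _ => le_of_eq ?_) h
  congr 1
  rw [← norm_star]
  congr 1
  simp [Matrix.toLpLin_apply, Matrix.mulVec, dotProduct, PiLp.inner_apply]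

/-- Taking adjoints, W Bᴴ = 1, so W is onto and has rank r. -/
theorem singularValue_pos_of_mul_conjTranspose_eq_one {r k : ℕ} {B W : Matrix (Fin r) (Fin k) ℂ}
    (hB : B * Wᴴ = 1) (l : Fin r) : l < k ∧ 0 < singularValue W l := by
  have hW : W * Bᴴ = 1 := by
    rw [← Matrix.conjTranspose_conjTranspose W, ← Matrix.conjTranspose_mul, hB,
      Matrix.conjTranspose_one]
  have hsurj : LinearMap.range (Matrix.toEuclideanLin W) = ⊤ := by
    refine LinearMap.range_eq_top.2 fun y => ⟨Matrix.toEuclideanLin Bᴴ y, ?_⟩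
    simp [Matrix.toLpLin_apply, Matrix.mulVec_mulVec, hW]
  constructor
  · have h := LinearMap.finrank_range_le (Matrix.toEuclideanLin W)
    rw [hsurj, finrank_top, finrank_euclideanSpace_fin, finrank_euclideanSpace_fin] at h
    exact l.2.trans_le h
  · rw [singularValue, LinearMap.singularValues_pos_iff_lt_finrank_range, hsurj, finrank_top,
      finrank_euclideanSpace_fin]
    exact l.2

/-- The squared Frobenius norm of a left inverse of `Wᴴ` is at least the sum of the inverse squared
singular values of `W`. -/
theorem sum_inv_sq_singularValue_le {r k : ℕ} {B W : Matrix (Fin r) (Fin k) ℂ}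
    (hB : B * Wᴴ = 1) :
    ∑ l : Fin r, (singularValue W l ^ 2)⁻¹ ≤ ∑ i, ∑ j, ‖B i j‖ ^ 2 := by
  set T := Matrix.toEuclideanLin W
  have hk : Module.finrank ℂ (EuclideanSpace ℂ (Fin k)) = k := finrank_euclideanSpace_fin
  let v := T.isSymmetric_adjoint_comp_self.eigenvectorBasis hk
  have hlk := fun l => (singularValue_pos_of_mul_conjTranspose_eq_one hB l).1
  let w : Fin r → EuclideanSpace ℂ (Fin k) := fun l => v ⟨l, hlk l⟩
  have hw : Orthonormal ℂ w := v.orthonormal.comp _ fun a b hab => by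
    simpa [Fin.ext_iff] using hab
  refine le_trans (Finset.sum_le_sum fun l _ => ?_) (sum_norm_sq_toEuclideanLin_le B hw)
  have hσ : 0 < singularValue W l := (singularValue_pos_of_mul_conjTranspose_eq_one hB l).2
  have he : LinearMap.adjoint T (T (w l)) = ((singularValue W l ^ 2 : ℝ) : ℂ) • w l := by
    have h := T.isSymmetric_adjoint_comp_self.apply_eigenvectorBasis hk ⟨l, hlk l⟩
    rw [← T.sq_singularValues_of_lt hk (hlk l)] at h
    exact h
  have hinv : ∀ y, Matrix.toEuclideanLin B (LinearMap.adjoint T y) = y := fun y => by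
    rw [← Matrix.toEuclideanLin_conjTranspose_eq_adjoint]
    simp [Matrix.toLpLin_apply, Matrix.mulVec_mulVec, hB]
  -- Applying B to Wᴴ W w = σ² w cancels Wᴴ and leaves W w = σ² B w. As ‖W w‖ = σ, this yields ‖B
  -- w‖² = σ⁻² for each of these right singular vectors.
  have h1 : T (w l) = ((singularValue W l ^ 2 : ℝ) : ℂ) • Matrix.toEuclideanLin B (w l) := by
    rw [← map_smul, ← he, hinv]
  have h2 : ‖T (w l)‖ ^ 2 = singularValue W l ^ 2 := by
    have h : inner ℂ (T (w l)) (T (w l)) = ((singularValue W l ^ 2 : ℝ) : ℂ) := by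
      rw [← LinearMap.adjoint_inner_right, he, inner_smul_right, inner_self_eq_norm_sq_to_K,
        hw.1 l]
      simp
    rw [inner_self_eq_norm_sq_to_K] at h
    exact Complex.ofReal_injective ((Complex.ofReal_pow _ _).trans h)
  rw [h1, norm_smul, mul_pow, Complex.norm_real, Real.norm_of_nonneg (by positivity)] at h2
  refine le_of_eq ?_
  field_simp
  have h3 : singularValue W l ^ 2 ≠ 0 := by positivity
  refine mul_left_cancel₀ h3 ?_
  linarith

/-! ### Convolution as a bilinear map. -/

theorem toeplitz_mulVec_apply {a b : ℕ} (v : Fin a → ℂ) (w : Fin b → ℂ) (r : ℕ) (i : Fin r) :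
    (toeplitz v r b *ᵥ w) i =
      ∑ j : Fin b, ∑ l : Fin a, if (j : ℕ) + l = i then v l * w j else 0 := by
  simp only [Matrix.mulVec, dotProduct, toeplitz, Matrix.of_apply]
  refine Finset.sum_congr rfl fun j _ => ?_
  split_ifs with h
  · rw [Finset.sum_eq_single ⟨(i : ℕ) - j, h.2⟩]
    · rw [if_pos (Nat.add_sub_cancel' h.1)]
    · intro l _ hl
      refine if_neg fun hi => hl (Fin.ext ?_)
      simp only
      omega
    · simp
  · rw [zero_mul]
    refine (Finset.sum_eq_zero fun l _ => if_neg fun hi => h ?_).symm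
    have := l.2
    omega

/-- Convolution is commutative. -/
theorem toeplitz_mulVec_comm {a b : ℕ} (v : Fin a → ℂ) (w : Fin b → ℂ) (r : ℕ) :
    toeplitz v r b *ᵥ w = toeplitz w r a *ᵥ v := by
  ext i
  rw [toeplitz_mulVec_apply, toeplitz_mulVec_apply, Finset.sum_comm]
  simp only [add_comm, mul_comm]

theorem toeplitz_smul {a : ℕ} (z : ℂ) (v : Fin a → ℂ) (r c : ℕ) :
    toeplitz (z • v) r c = z • toeplitz v r c := by
  ext i j
  simp only [toeplitz, Matrix.of_apply, Matrix.smul_apply, Pi.smul_apply, smul_eq_mul]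
  split_ifs <;> simp

theorem toeplitz_mulVec_path {a b : ℕ} (h δ : Fin a → ℂ) (x z : Fin b → ℂ) (r : ℕ) (t : ℂ) :
    toeplitz (h + t • δ) r b *ᵥ (x + t • z) =
      toeplitz h r b *ᵥ x + ((t • (toeplitz δ r b *ᵥ x + toeplitz h r b *ᵥ z)) +
        t ^ 2 • (toeplitz δ r b *ᵥ z)) := by
  rw [toeplitz_mulVec_comm (h + t • δ), toeplitz_mulVec_comm δ, toeplitz_mulVec_comm δ,
    Matrix.mulVec_add, Matrix.mulVec_smul, toeplitz_mulVec_comm _ h, toeplitz_mulVec_comm _ δ,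
    toeplitz_mulVec_comm _ δ, Matrix.mulVec_add, Matrix.mulVec_smul, Matrix.mulVec_add,
    Matrix.mulVec_smul]
  simp only [smul_add, smul_smul, pow_two, toeplitz_mulVec_comm z δ]
  abel

/-! ### Score identities for unbiased estimators. -/

/-- The `i`-th coordinate of the estimation error at `θ`, as a function of the noise. -/
def estimationError {L K : ℕ} (hhat : (Fin (K + L) → ℂ) → (Fin (L + 1) → ℂ))
    (θ : (Fin (L + 1) → ℂ) × (Fin K → ℂ)) (i : Fin (L + 1)) (n : Fin (K + L) → ℂ) : ℂ :=
  hhat (toeplitz θ.1 (K + L) K *ᵥ θ.2 + n) i - θ.1 i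

variable {L K : ℕ} {Θ : Set ((Fin (L + 1) → ℂ) × (Fin K → ℂ))}
  {hhat : (Fin (K + L) → ℂ) → (Fin (L + 1) → ℂ)}

theorem IsUnbiasedChannelEstimator.measurable_estimationError
    (hu : IsUnbiasedChannelEstimator Θ hhat) (θ : (Fin (L + 1) → ℂ) × (Fin K → ℂ))
    (i : Fin (L + 1)) : Measurable (estimationError hhat θ i) :=
  ((measurable_pi_apply i).comp (hu.1.comp (measurable_const_add _))).sub_const _

/-- The centre `b` is free so that it can stay at the true channel while the parameter moves along a
line. -/
theorem IsUnbiasedChannelEstimator.integral_estimationError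
    (hu : IsUnbiasedChannelEstimator Θ hhat) {θ : (Fin (L + 1) → ℂ) × (Fin K → ℂ)}
    (hθ : θ ∈ Θ) (b : ℂ) (i : Fin (L + 1)) :
    ∫ n, (hhat (toeplitz θ.1 (K + L) K *ᵥ θ.2 + n) i - b) ∂noiseLaw (K + L) = θ.1 i - b := by
  obtain ⟨hint, hmean⟩ := hu.2 θ hθ
  have hint' : Integrable (fun n => hhat (toeplitz θ.1 (K + L) K *ᵥ θ.2 + n) i)
      (noiseLaw (K + L)) :=
    (integrable_map_measure (hint.eval i).1 (by fun_prop)).1 (hint.eval i)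
  rw [integral_sub hint' (integrable_const _), integral_const]
  have h1 : ∫ n, hhat (toeplitz θ.1 (K + L) K *ᵥ θ.2 + n) i ∂noiseLaw (K + L) = θ.1 i := by
    conv_rhs => rw [← hmean]
    rw [eval_integral fun i => hint.eval i, receivedLaw]
    exact (integral_map (by fun_prop) (hint.eval i).1).symm
  simp [h1]

/-- The score identity in a real direction `(δ, z)` of the parameter space. -/
theorem IsUnbiasedChannelEstimator.integral_score_mul
    (hu : IsUnbiasedChannelEstimator Θ hhat) {h δ : Fin (L + 1) → ℂ} {x z : Fin K → ℂ}
    (hpath : ∀ t : ℝ, (h + (t : ℂ) • δ, x + (t : ℂ) • z) ∈ Θ) {i : Fin (L + 1)}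
    (hg : MemLp (estimationError hhat (h, x) i) 2 (noiseLaw (K + L)))
    {D : Fin (K + L) → ℂ}
    (hD : D = toeplitz δ (K + L) K *ᵥ x + toeplitz h (K + L) K *ᵥ z) :
    ∫ n, ((∑ j, 2 * (star (D j) * n j).re : ℝ) : ℂ) * estimationError hhat (h, x) i n
      ∂noiseLaw (K + L) = δ i := by
  have hd := hasDerivAt_integral_likelihoodRatio hg D (toeplitz δ (K + L) K *ᵥ z)
  -- By unbiasedness at the displaced parameter, the differentiated integral equals t δ i for every
  -- real t.
  refine hd.unique ?_
  have hlin : HasDerivAt (fun t : ℝ => (t : ℂ) * δ i) (δ i) 0 := by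
    simpa using ((hasDerivAt_id (0 : ℝ)).ofReal_comp).mul_const (δ i)
  refine hlin.congr_of_eventuallyEq (.of_forall fun t => ?_)
  have h1 := hu.integral_estimationError (hpath t) (h i) i
  simp only [toeplitz_mulVec_path, Pi.add_apply, Pi.smul_apply, smul_eq_mul,
    add_sub_cancel_left] at h1
  simp only
  rw [← h1, ← hD]
  have h2 := integral_const_add_noiseLaw
    ((t : ℂ) • D + (t : ℂ) ^ 2 • (toeplitz δ (K + L) K *ᵥ z))
    (hu.measurable_estimationError (h, x) i)
  simp only [estimationError, add_assoc] at h2 ⊢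
  exact h2.symm

/-- The correlation matrix `E[(ĥ(y) - h) nᴴ]` of the estimation error with the noise. -/
def errorNoiseCorrelation (hhat : (Fin (K + L) → ℂ) → (Fin (L + 1) → ℂ))
    (θ : (Fin (L + 1) → ℂ) × (Fin K → ℂ)) : Matrix (Fin (L + 1)) (Fin (K + L)) ℂ :=
  Matrix.of fun i j => ∫ n, estimationError hhat θ i n * star (n j) ∂noiseLaw (K + L)

/-- A real direction only gives the score 2 Re(Dᴴ n). The direction multiplied by i gives the score
of iD, and 2 nᴴ D = 2 Re(Dᴴ n) - i · 2 Re((iD)ᴴ n). The right-hand sides combine to δ - i(iδ) = 2δ.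
Hence complex lines in Θ are needed. -/
theorem IsUnbiasedChannelEstimator.errorNoiseCorrelation_mulVec
    (hu : IsUnbiasedChannelEstimator Θ hhat) {h δ : Fin (L + 1) → ℂ} {x z : Fin K → ℂ}
    (hpath : ∀ t : ℂ, (h + t • δ, x + t • z) ∈ Θ)
    (hg : ∀ i, MemLp (estimationError hhat (h, x) i) 2 (noiseLaw (K + L))) :
    errorNoiseCorrelation hhat (h, x) *ᵥ
      (toeplitz δ (K + L) K *ᵥ x + toeplitz h (K + L) K *ᵥ z) = δ := by
  set D := toeplitz δ (K + L) K *ᵥ x + toeplitz h (K + L) K *ᵥ z with hD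
  ext i
  have h1 := hu.integral_score_mul (fun t => hpath t) (hg i) hD
  have h2 := hu.integral_score_mul (δ := Complex.I • δ) (z := Complex.I • z)
    (fun t => by simpa only [smul_smul] using hpath (t * Complex.I)) (hg i)
    (D := Complex.I • D) (by rw [toeplitz_smul, Matrix.smul_mulVec, Matrix.mulVec_smul, hD,
      smul_add])
  have hint : ∀ j, Integrable (fun n => estimationError hhat (h, x) i n * star (n j))
      (noiseLaw (K + L)) := fun j =>
    (hg i).integrable_mul (memLp_noiseLaw_apply j).star
  have hre : ∀ E : Fin (K + L) → ℂ, Integrable (fun n => ((∑ j, 2 * (star (E j) * n j).re : ℝ) : ℂ)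
      * estimationError hhat (h, x) i n) (noiseLaw (K + L)) := by
    intro E
    have hm : MemLp (fun n : Fin (K + L) → ℂ => ∑ j, 2 * (star (E j) * n j).re) 2
        (noiseLaw (K + L)) :=
      memLp_finsetSum _ fun j _ => ((memLp_noiseLaw_apply j).const_mul (star (E j))).re.const_mul 2
    exact hm.ofReal.integrable_mul (hg i)
  have h3 : (2 : ℂ) * (errorNoiseCorrelation hhat (h, x) *ᵥ D) i = 2 * δ i := by
    calc (2 : ℂ) * (errorNoiseCorrelation hhat (h, x) *ᵥ D) i
        = ∫ n, ∑ j, 2 * (estimationError hhat (h, x) i n * star (n j) * D j)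
            ∂noiseLaw (K + L) := by
          rw [integral_finsetSum _ fun j _ => ((hint j).mul_const _).const_mul _]
          simp only [Matrix.mulVec, dotProduct, errorNoiseCorrelation, Matrix.of_apply,
            Finset.mul_sum, integral_const_mul, integral_mul_const]
      _ = ∫ n, (((∑ j, 2 * (star (D j) * n j).re : ℝ) : ℂ) * estimationError hhat (h, x) i n -
            Complex.I * (((∑ j, 2 * (star ((Complex.I • D) j) * n j).re : ℝ) : ℂ) *
              estimationError hhat (h, x) i n)) ∂noiseLaw (K + L) := by
          refine integral_congr_ae (.of_forall fun n => ?_)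
          simp only
          rw [← mul_assoc, ← sub_mul, Complex.ofReal_sum, Complex.ofReal_sum, Finset.mul_sum,
            ← Finset.sum_sub_distrib, Finset.sum_mul]
          refine Finset.sum_congr rfl fun j _ => ?_
          have hz : 2 * (star (n j) * D j) = ((2 * (star (D j) * n j).re : ℝ) : ℂ) -
              Complex.I * ((2 * (star ((Complex.I • D) j) * n j).re : ℝ) : ℂ) := by
            apply Complex.ext
            · simp; ring
            · simp; ring
          rw [← hz]
          ring
      _ = δ i - Complex.I * (Complex.I • δ) i := by
          rw [integral_sub (hre D) ((hre _).const_mul _), h1, integral_const_mul, h2]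
      _ = 2 * δ i := by
          rw [Pi.smul_apply, smul_eq_mul, ← mul_assoc, Complex.I_mul_I]
          ring
  exact mul_left_cancel₀ two_ne_zero h3

theorem meanSquareError_eq_sum (hm : Measurable hhat) (θ : (Fin (L + 1) → ℂ) × (Fin K → ℂ)) :
    meanSquareError hhat θ = ∑ i, ∫⁻ n, ‖estimationError hhat θ i n‖ₑ ^ 2 ∂noiseLaw (K + L) := by
  have hsq : ∀ v : Fin (L + 1) → ℂ, ‖WithLp.toLp 2 v‖ₑ ^ 2 = ∑ i, ‖v i‖ₑ ^ 2 := fun v => by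
    simp only [← ofReal_norm, ← ENNReal.ofReal_pow (norm_nonneg _)]
    rw [EuclideanSpace.norm_sq_eq, ENNReal.ofReal_sum_of_nonneg fun i _ => by positivity]
  simp only [meanSquareError, hsq]
  rw [lintegral_finsetSum _ fun i _ => by fun_prop, receivedLaw]
  refine Finset.sum_congr rfl fun i _ => ?_
  rw [lintegral_map (by fun_prop) (by fun_prop)]
  rfl

/-- Row i of the correlation matrix holds the coefficients of the i-th error against the orthonormal
noise coordinates, so Bessel's inequality applies row by row. -/
theorem sum_norm_sq_errorNoiseCorrelation_le (hm : Measurable hhat)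
    {θ : (Fin (L + 1) → ℂ) × (Fin K → ℂ)}
    (hg : ∀ i, MemLp (estimationError hhat θ i) 2 (noiseLaw (K + L))) :
    ENNReal.ofReal (∑ i, ∑ j, ‖errorNoiseCorrelation hhat θ i j‖ ^ 2) ≤
      meanSquareError hhat θ := by
  rw [meanSquareError_eq_sum hm,
    ENNReal.ofReal_sum_of_nonneg fun i _ => Finset.sum_nonneg fun j _ => by positivity]
  refine Finset.sum_le_sum fun i _ => ?_
  refine (ENNReal.ofReal_le_ofReal (sum_norm_sq_integral_mul_star_le (hg i))).trans ?_
  rw [ofReal_integral_eq_lintegral_ofReal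
    ((memLp_two_iff_integrable_sq_norm (hg i).1).1 (hg i)) (.of_forall fun n => by positivity)]
  simp only [ENNReal.ofReal_pow (norm_nonneg _), ofReal_norm, le_refl]

theorem memLp_estimationError_of_meanSquareError_ne_top (hu : IsUnbiasedChannelEstimator Θ hhat)
    {θ : (Fin (L + 1) → ℂ) × (Fin K → ℂ)} (hfin : meanSquareError hhat θ ≠ ∞) (i : Fin (L + 1)) :
    MemLp (estimationError hhat θ i) 2 (noiseLaw (K + L)) := by
  have hm := (hu.measurable_estimationError θ i).aestronglyMeasurable (μ := noiseLaw (K + L))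
  rw [meanSquareError_eq_sum hu.1, ENNReal.sum_ne_top] at hfin
  refine (memLp_two_iff_integrable_sq_norm hm).2 ⟨hm.norm.pow 2, ?_⟩
  rw [hasFiniteIntegral_iff_enorm]
  simpa [enorm_pow] using (hfin i (Finset.mem_univ i)).lt_top

/-! ### Null space bases, the precoder and the constraints. -/

/-- A matrix that annihilates `H` factors through an orthonormal basis of the left null space of
`H`. -/
theorem IsOrthonormalBasisOf.mul_mul_conjTranspose {m n k r : ℕ} {U : Matrix (Fin m) (Fin k) ℂ}
    {H : Matrix (Fin m) (Fin n) ℂ} (hU : IsOrthonormalBasisOf U (leftNullSpace H))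
    {C : Matrix (Fin r) (Fin m) ℂ} (hC : C * H = 0) : C * U * Uᴴ = C := by
  have h1 : ∀ i, ∃ y, U *ᵥ y = Cᴴ.col i := fun i => by
    have hmem : Cᴴ.col i ∈ leftNullSpace H := by
      rw [leftNullSpace, LinearMap.mem_ker, Matrix.mulVecLin_apply]
      have h2 : Hᴴ * Cᴴ = 0 := by rw [← Matrix.conjTranspose_mul, hC, Matrix.conjTranspose_zero]
      ext j
      exact congrFun (congrFun h2 j) i
    rw [← hU.2] at hmem
    exact hmem
  choose y hy using h1
  have h3 : Cᴴ = U * (Matrix.of y)ᵀ := by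
    ext a i
    exact (congrFun (hy i) a).symm
  -- U Uᴴ is the orthogonal projection onto the left null space, which contains the columns of Cᴴ.
  have h4 : U * (Uᴴ * Cᴴ) = Cᴴ := by
    rw [h3, ← Matrix.mul_assoc Uᴴ, hU.1, Matrix.one_mul]
  have h5 := congrArg Matrix.conjTranspose h4
  simpa [Matrix.conjTranspose_mul] using h5

theorem sum_norm_sq_mul_le {m k r : ℕ} {U : Matrix (Fin m) (Fin k) ℂ} (hU : Uᴴ * U = 1)
    (C : Matrix (Fin r) (Fin m) ℂ) :
    ∑ i, ∑ j, ‖(C * U) i j‖ ^ 2 ≤ ∑ i, ∑ j, ‖C i j‖ ^ 2 := by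
  have ho : Orthonormal ℂ fun l => (WithLp.toLp 2 (U.col l) : EuclideanSpace ℂ (Fin m)) := by
    rw [orthonormal_iff_ite]
    intro a b
    have h := congrFun (congrFun hU a) b
    rw [Matrix.one_apply] at h
    rw [← h]
    simp [PiLp.inner_apply, Matrix.mul_apply, mul_comm]
  refine le_trans (le_of_eq ?_) (sum_norm_sq_toEuclideanLin_le C ho)
  simp_rw [EuclideanSpace.norm_sq_eq]
  rw [Finset.sum_comm]
  rfl

theorem pinv_mul_self {m n : ℕ} {G : Matrix (Fin m) (Fin n) ℂ} (hG : G.rank = n) :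
    pinv G * G = 1 := by
  have h2 : (Gᴴ * G).rank = n := by
    open scoped ComplexOrder in rw [Matrix.rank_conjTranspose_mul_self, hG]
  have h3 : LinearMap.range (Gᴴ * G).mulVecLin = ⊤ :=
    Submodule.eq_top_of_finrank_eq (by rw [← Matrix.rank, h2, Module.finrank_fin_fun])
  have hu : IsUnit (Gᴴ * G) := Matrix.mulVec_surjective_iff_isUnit.1 (LinearMap.range_eq_top.1 h3)
  rw [pinv, Matrix.mul_assoc]
  exact Matrix.nonsing_inv_mul _ ((Matrix.isUnit_iff_isUnit_det _).1 hu)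

/-- I ⊗ F† is a left inverse of I ⊗ F. -/
theorem rank_blockPrecoder (N : ℕ) {P M : ℕ} {F : Matrix (Fin P) (Fin M) ℂ} (hF : F.rank = M) :
    (blockPrecoder N F).rank = N * M := by
  have h1 : Matrix.reindex finProdFinEquiv finProdFinEquiv
      ((1 : Matrix (Fin N) (Fin N) ℂ) ⊗ₖ pinv F) * blockPrecoder N F = 1 := by
    rw [blockPrecoder, Matrix.reindex_apply, Matrix.reindex_apply, Matrix.submatrix_mul_equiv,
      ← Matrix.mul_kronecker_mul, pinv_mul_self hF, Matrix.one_mul, Matrix.one_kronecker_one,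
      Matrix.submatrix_one_equiv]
  refine le_antisymm (Matrix.rank_le_width _) ?_
  calc N * M = (1 : Matrix (Fin (N * M)) (Fin (N * M)) ℂ).rank := by simp
    _ ≤ (blockPrecoder N F).rank := by rw [← h1]; exact Matrix.rank_mul_le_right _ _

theorem constraintMatrix_mulVec_smul_mulVec {K R u q : ℕ} {γ : ℝ}
    {G : Matrix (Fin K) (Fin R) ℂ} (hG : G.rank = R) {Un : Matrix (Fin K) (Fin u) ℂ}
    (hUn : IsOrthonormalBasisOf Un (leftNullSpace G)) {A : Matrix (Fin q) (Fin R) ℂ}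
    {s : Fin R → ℂ} {c : Fin q → ℂ} (hs : A *ᵥ s = c) :
    constraintMatrix G Un A *ᵥ (((√γ : ℝ) : ℂ) • (G *ᵥ s)) =
      Sum.elim (0 : Fin u → ℂ) (((√γ : ℝ) : ℂ) • c) := by
  have h1 : Gᴴ * Un = 0 := by
    refine Matrix.ext_of_mulVec_single fun j => ?_
    have hj : Un *ᵥ Pi.single j 1 ∈ leftNullSpace G := by
      rw [← hUn.2]; exact ⟨_, rfl⟩
    rw [leftNullSpace, LinearMap.mem_ker, Matrix.mulVecLin_apply, Matrix.mulVec_mulVec] at hj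
    rw [hj, Matrix.zero_mulVec]
  have h2 : Unᴴ * G = 0 := by
    have := congrArg Matrix.conjTranspose h1
    simpa [Matrix.conjTranspose_mul] using this
  rw [constraintMatrix, Matrix.fromRows_mulVec, Matrix.mulVec_smul, Matrix.mulVec_smul,
    Matrix.mulVec_mulVec, Matrix.mulVec_mulVec, h2, Matrix.zero_mulVec, smul_zero,
    Matrix.mul_assoc, pinv_mul_self hG, Matrix.mul_one, hs]

/-- The correlation matrix of the error of an unbiased semi-blind channel estimator with the noise
is a left inverse of the sensitivity to the channel, and annihilates the sensitivity to the channel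
input. -/
theorem IsUnbiasedChannelEstimator.errorNoiseCorrelation_mul_toeplitz
    {R u q e : ℕ} {γ : ℝ} {G : Matrix (Fin K) (Fin R) ℂ} {Un : Matrix (Fin K) (Fin u) ℂ}
    {A : Matrix (Fin q) (Fin R) ℂ} {c : Fin q → ℂ}
    (hu : IsUnbiasedChannelEstimator (parameterSpace L γ G Un A c) hhat)
    {E : Matrix (Fin K) (Fin e) ℂ}
    (hE : IsOrthonormalBasisOf E (LinearMap.ker (constraintMatrix G Un A).mulVecLin))
    {h : Fin (L + 1) → ℂ} {x : Fin K → ℂ} (hx : (h, x) ∈ parameterSpace L γ G Un A c)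
    (hg : ∀ i, MemLp (estimationError hhat (h, x) i) 2 (noiseLaw (K + L))) :
    errorNoiseCorrelation hhat (h, x) * toeplitz x (K + L) (L + 1) = 1 ∧
      errorNoiseCorrelation hhat (h, x) * (toeplitz h (K + L) K * E) = 0 := by
  have key : ∀ (δ : Fin (L + 1) → ℂ) (w : Fin e → ℂ), errorNoiseCorrelation hhat (h, x) *ᵥ
      (toeplitz δ (K + L) K *ᵥ x + toeplitz h (K + L) K *ᵥ (E *ᵥ w)) = δ := by
    intro δ w
    -- The constraint is affine in x and leaves h free, so the complex line in direction (δ, E w)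
    -- stays in Θ.
    refine hu.errorNoiseCorrelation_mulVec (fun t => ?_) hg
    have hw : E *ᵥ w ∈ LinearMap.ker (constraintMatrix G Un A).mulVecLin := by
      rw [← hE.2]; exact ⟨_, rfl⟩
    rw [LinearMap.mem_ker, Matrix.mulVecLin_apply] at hw
    have hx' : constraintMatrix G Un A *ᵥ x = _ := hx
    change constraintMatrix G Un A *ᵥ (x + t • (E *ᵥ w)) = _
    rw [Matrix.mulVec_add, Matrix.mulVec_smul, hw, smul_zero, add_zero, hx']
  constructor
  · refine Matrix.ext_of_mulVec_single fun j => ?_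
    -- With w = 0, commutativity 𝒯_δ x = 𝒯_x δ turns the identity into C 𝒯_x δ = δ.
    have h1 := key (Pi.single j 1) 0
    rw [Matrix.mulVec_zero, Matrix.mulVec_zero, add_zero, toeplitz_mulVec_comm,
      Matrix.mulVec_mulVec] at h1
    rw [h1, Matrix.one_mulVec]
  · refine Matrix.ext_of_mulVec_single fun j => ?_
    have h1 := key 0 (Pi.single j 1)
    rw [toeplitz_mulVec_comm, Matrix.mulVec_zero, zero_add, Matrix.mulVec_mulVec,
      Matrix.mulVec_mulVec, Matrix.mul_assoc] at h1
    rw [h1, Matrix.zero_mulVec]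

end SemiBlind

end

/-! ### The variance bound. -/

theorem mainTheorem5 (L M N : ℕ) (γ : ℝ) (hγ : 0 < γ)
    -- the precoder (`P = M + L`), of full rank, and the pilot constraint `A s = c`
    (F : Matrix (Fin (M + L)) (Fin M) ℂ) (hF : F.rank = M)
    (q : ℕ) (A : Matrix (Fin q) (Fin (N * M)) ℂ) (c : Fin q → ℂ)
    -- an orthonormal basis of the left null space of `I ⊗ F`
    (u : ℕ) (Un : Matrix (Fin (N * (M + L))) (Fin u) ℂ)
    (hUn : SemiBlind.IsOrthonormalBasisOf Un
      (SemiBlind.leftNullSpace (SemiBlind.blockPrecoder N F)))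
    -- an orthonormal basis of the null space of `[U_nᴴ; A (I ⊗ F)†]`
    (e : ℕ) (E : Matrix (Fin (N * (M + L))) (Fin e) ℂ)
    (hE : SemiBlind.IsOrthonormalBasisOf E (LinearMap.ker
      (SemiBlind.constraintMatrix (SemiBlind.blockPrecoder N F) Un A).mulVecLin))
    -- an unbiased semi-blind channel estimator
    (hhat : (Fin (N * (M + L) + L) → ℂ) → (Fin (L + 1) → ℂ))
    (hhat_unbiased : SemiBlind.IsUnbiasedChannelEstimator
      (SemiBlind.parameterSpace L γ (SemiBlind.blockPrecoder N F) Un A c) hhat)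
    -- the true channel and the true source symbols
    (h : Fin (L + 1) → ℂ) (s : Fin (N * M) → ℂ) (hs : A *ᵥ s = c)
    -- an orthonormal basis of the left null space of `𝒯_h E`
    (k : ℕ) (U : Matrix (Fin (N * (M + L) + L)) (Fin k) ℂ)
    (hU : SemiBlind.IsOrthonormalBasisOf U (SemiBlind.leftNullSpace
      (SemiBlind.toeplitz h (N * (M + L) + L) (N * (M + L)) * E))) :
    ENNReal.ofReal (1 / γ) * ∑ l : Fin (L + 1),
        (ENNReal.ofReal (SemiBlind.singularValue
          ((SemiBlind.toeplitz (SemiBlind.blockPrecoder N F *ᵥ s)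
            (N * (M + L) + L) (L + 1))ᴴ * U) l) ^ 2)⁻¹
      ≤ SemiBlind.meanSquareError hhat
          (h, ((√γ : ℝ) : ℂ) • (SemiBlind.blockPrecoder N F *ᵥ s)) := by
  have hx : (h, ((√γ : ℝ) : ℂ) • (SemiBlind.blockPrecoder N F *ᵥ s)) ∈
      SemiBlind.parameterSpace L γ (SemiBlind.blockPrecoder N F) Un A c :=
    SemiBlind.constraintMatrix_mulVec_smul_mulVec (SemiBlind.rank_blockPrecoder N hF) hUn hs
  by_cases hfin : SemiBlind.meanSquareError hhat
      (h, ((√γ : ℝ) : ℂ) • (SemiBlind.blockPrecoder N F *ᵥ s)) = ∞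
  · rw [hfin]; exact le_top
  have hg := SemiBlind.memLp_estimationError_of_meanSquareError_ne_top hhat_unbiased hfin
  obtain ⟨hCX, hCH⟩ := hhat_unbiased.errorNoiseCorrelation_mul_toeplitz hE hx hg
  have hle := SemiBlind.sum_norm_sq_errorNoiseCorrelation_le hhat_unbiased.1 hg
  set C := SemiBlind.errorNoiseCorrelation hhat
    (h, ((√γ : ℝ) : ℂ) • (SemiBlind.blockPrecoder N F *ᵥ s))
  -- The factor √γ comes from 𝒯_x = √γ 𝒯_{Gs}, and C U Uᴴ = C removes the projection.
  have hB : (((√γ : ℝ) : ℂ) • (C * U)) * ((SemiBlind.toeplitz (SemiBlind.blockPrecoder N F *ᵥ s)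
      (N * (M + L) + L) (L + 1))ᴴ * U)ᴴ = 1 := by
    rw [Matrix.conjTranspose_mul, Matrix.conjTranspose_conjTranspose, Matrix.smul_mul,
      ← Matrix.mul_assoc, hU.mul_mul_conjTranspose hCH, ← hCX, SemiBlind.toeplitz_smul,
      Matrix.mul_smul]
  refine le_trans ?_ hle
  refine le_trans ?_ (ENNReal.ofReal_le_ofReal (SemiBlind.sum_norm_sq_mul_le hU.1 C))
  have hsum := SemiBlind.sum_inv_sq_singularValue_le hB
  have hscale : ∑ i, ∑ j, ‖(((√γ : ℝ) : ℂ) • (C * U)) i j‖ ^ 2 =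
      γ * ∑ i, ∑ j, ‖(C * U) i j‖ ^ 2 := by
    simp only [Matrix.smul_apply, norm_smul, mul_pow, Complex.norm_real, Real.norm_eq_abs,
      sq_abs, Real.sq_sqrt hγ.le, Finset.mul_sum]
  rw [hscale] at hsum
  -- Positivity makes the inverses in [0, ∞] agree with real inverses; a zero singular value can
  -- only occur in the infinite case settled above.
  have hpos := fun l => (SemiBlind.singularValue_pos_of_mul_conjTranspose_eq_one hB l).2
  calc _ = ENNReal.ofReal (1 / γ * ∑ l : Fin (L + 1), (SemiBlind.singularValue
          ((SemiBlind.toeplitz (SemiBlind.blockPrecoder N F *ᵥ s)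
            (N * (M + L) + L) (L + 1))ᴴ * U) l ^ 2)⁻¹) := by
        rw [ENNReal.ofReal_mul (by positivity),
          ENNReal.ofReal_sum_of_nonneg fun i _ => by positivity]
        congr 1
        refine Finset.sum_congr rfl fun l _ => ?_
        rw [ENNReal.ofReal_inv_of_pos (pow_pos (hpos l) 2), ENNReal.ofReal_pow (hpos l).le]
    _ ≤ _ := by
        refine ENNReal.ofReal_le_ofReal ?_
        rw [one_div, inv_mul_le_iff₀ hγ]
        exact hsum
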